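/- **Setting.** $\mathbb S^n$ is the space of real symmetric $n\times n$ matrices. A graph is finite, may have multiple edges and loops, and has no isolated vertices (a vertex with a loop is not isolated); it is given by its symmetric adjacency matrix $H$ with entries in $\mathbb N$ ($H_{i,i}$ is the number of loops at $i$). $[H]$ is its isomorphism class, $|V(H)|$ the number of vertices, $|H|=\sum_{i\le j}H_{i,j}$ the number of edges, $\ell(H)=\sum_i H_{i,i}$ the number of loops, $H!=\prod_{i\le j}H_{i,j}!$, and $X^H=\prod_{i\le j}X_{i,j}^{H_{i,j}}$. The empty graph is included. Let $$m_n^{[H]}(X)=\sum_G X^G,$$ the sum over all distinct graphs $G$ on the vertex set $[n]$ obtained by labeling the vertices of $H$ by distinct elements of $[n]$ (so $m_n^{[H]}=0$ if $n<|V(H)|$), and $$\mathrm{hom}(H;X)=\sum_{f:V(H)\to[n]}\ \prod_{i\le j}X_{f(i),f(j)}^{H_{i,j}},$$ with $\mathrm{inj}(H;X)$ the same sum over injective $f$ only ($X\in\mathbb S^n$). For $f:[n]\to[k]$ and $X\in\mathbb S^n$, the quotient $X/P_f\in\mathbb S^k$ has as its $(i,j)$ entry the sum of $X_{a,b}$ over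 all unordered pairs $\{a,b\}$ (with $a=b$ allowed) such that $\{f(a),f(b)\}=\{i,j\}$, while $\rho(f)^\star X\in\mathbb S^k$ has as its $(i,j)$ entry the sum of $X_{a,b}$ over all ordered pairs $(a,b)$ with $f(a)=i$, $f(b)=j$. (They differ only on the diagonal, where $\rho(f)^\star$ counts each collapsed edge twice.) Write $[G]\le_R[H]$ if there is a surjection $f:V(G)\to V(H)$ with $G/P_f=H$, and let $R_{[G],[H]}$ be the number of such surjections. Let $(k)_\ell=k!/(k-\ell)!$. For $k\ge1$ let $F:[n]\to[k]$ be a uniformly random map and set, for $X\in\mathbb S^n$, $$p_n^{(k,[H])}(X)=\mathbb E\big[m_k^{[H]}(X/P_F)\big],\qquad \tilde p_n^{(k,[H])}(X)=\mathbb E\big[m_k^{[H]}(\rho(F)^\star X)\big].$$ A *freely-described polynomial of degree at most $d$ over $\mathrm{Sym}^2\mathscr Z$* is a sequence $(p_n)_{n\in\mathbb N}$ in which $p_n$ is a polynomial of degree at most $d$ on $\mathbb S^n$, invariant under simultaneous permutations of rows and columns, such that for all $n\le N$ and $X\in\mathbb S^n$ the value of $p_N$ at the zero-padding of $X$ to size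 $N$ is $p_n(X)$. **Proposition.** (a) For every graph $H$ and every $k\ge1$ with $k\ge|V(H)|$, there are finitely many classes $[G]\le_R[H]$, and for all $n$ and $X\in\mathbb S^n$ $$p_n^{(k,[H])}(X)=\sum_{[G]\le_R[H]}\frac{H!}{G!}\cdot\frac{(k)_{|V(H)|}}{k^{|V(G)|}}\cdot\frac{R_{[G],[H]}}{R_{[H],[H]}}\,m_n^{[G]}(X),$$ $$\tilde p_n^{(k,[H])}(X)=\sum_{[G]\le_R[H]}2^{\ell(H)-\ell(G)}\,\frac{H!}{G!}\cdot\frac{(k)_{|V(H)|}}{k^{|V(G)|}}\cdot\frac{R_{[G],[H]}}{R_{[H],[H]}}\,m_n^{[G]}(X).$$ (b) Let $d\ge0$. As $[H]$ ranges over the isomorphism classes of graphs with at most $d$ edges, each of the collections $\{(p_n^{(k,[H])})_n\}$ and $\{(\tilde p_n^{(k,[H])})_n\}$ (for every $k\ge\max(1,2d)$), $\{(m_n^{[H]})_n\}$, $\{(\mathrm{inj}(H;\cdot)|_{\mathbb S^n})_n\}$ and $\{(\mathrm{hom}(H;\cdot)|_{\mathbb S^n})_n\}$ is a basis of the vector space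 of freely-described polynomials of degree at most $d$ over $\mathrm{Sym}^2\mathscr Z$. -/

import Mathlib

open Finset
open scoped BigOperators

/-- A symmetric `n × n` matrix with entries in `R`: the entry `X_{i,j} = X_{j,i}` is `X s(i, j)`.
Unordered pairs `s(i, j)` are in bijection with the index pairs `i ≤ j`. -/
abbrev SymMat (n : ℕ) (R : Type*) := Sym2 (Fin n) → R

/-- The quotient `X / P_f` of a weighted graph along `f : [n] → [k]`: the weight of the edge
(or loop) `{i, j}` is the sum of the weights of all edges and loops `{a, b}` of `X` with
`{f a, f b} = {i, j}`, every edge `{a, b}` being counted once. -/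
def quot {R : Type*} [AddCommMonoid R] {n k : ℕ} (f : Fin n → Fin k) (X : SymMat n R) :
    SymMat k R :=
  fun e => ∑ e' : Sym2 (Fin n) with e'.map f = e, X e'

/-- The adjoint action `ρ(f)^⋆` of `f : [n] → [k]` on symmetric matrices, i.e. `X ↦ A X Aᵀ` with
`A e_a = e_{f a}`: the `(i, j)` entry is the sum of `X_{a,b}` over ordered pairs `(a, b)`
with `f a = i`, `f b = j`. -/
def pushMat {n k : ℕ} (f : Fin n → Fin k) (X : SymMat n ℝ) : SymMat k ℝ :=
  Sym2.lift ⟨fun i j => ∑ a : Fin n with f a = i, ∑ b : Fin n with f b = j, X s(a, b), by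
    intro i j
    dsimp only
    rw [Finset.sum_comm]
    refine Finset.sum_congr rfl fun b _ => Finset.sum_congr rfl fun a _ => ?_
    rw [Sym2.eq_swap]⟩

/-- Zero-padding of a symmetric `n × n` matrix to size `N`. -/
def zeroPad {n N : ℕ} (X : SymMat n ℝ) : SymMat N ℝ :=
  Sym2.lift ⟨fun i j => if h : i.1 < n ∧ j.1 < n then X s(⟨i.1, h.1⟩, ⟨j.1, h.2⟩) else 0, by
    intro i j
    by_cases hi : i.1 < n <;> by_cases hj : j.1 < n <;> simp [hi, hj, Sym2.eq_swap]⟩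

/-- The simultaneous permutation of rows and columns, `(σ X)_{i,j} = X_{σ⁻¹ i, σ⁻¹ j}`. -/
def permute {n : ℕ} (σ : Equiv.Perm (Fin n)) (X : SymMat n ℝ) : SymMat n ℝ :=
  fun e => X (e.map σ.symm)

/-- The monomial `X^G = ∏_{i ≤ j} X_{i,j}^{G_{i,j}}`. -/
def monom {n : ℕ} (G : SymMat n ℕ) (X : SymMat n ℝ) : ℝ := ∏ e, X e ^ G e

/-- A finite graph, with multiple edges and loops allowed and without isolated vertices
(a vertex carrying a loop is not isolated), given by its adjacency matrix. -/
structure MGraph where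
  verts : ℕ
  adj : SymMat verts ℕ
  no_isolated : ∀ i, ∃ j, adj s(i, j) ≠ 0

namespace MGraph

/-- Graph isomorphism. -/
def Iso (G H : MGraph) : Prop :=
  ∃ e : Fin G.verts ≃ Fin H.verts, ∀ x, H.adj (x.map e) = G.adj x

theorem map_symm_map {α β : Type*} (e : α ≃ β) (x : Sym2 α) : (x.map e).map e.symm = x := by
  rw [Sym2.map_map]; simp

theorem map_map_symm {α β : Type*} (e : α ≃ β) (x : Sym2 β) : (x.map e.symm).map e = x := by
  rw [Sym2.map_map]; simp

/-- The bijection of unordered pairs induced by a bijection. -/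
def pairEquiv {α β : Type*} (e : α ≃ β) : Sym2 α ≃ Sym2 β where
  toFun := Sym2.map e
  invFun := Sym2.map e.symm
  left_inv := map_symm_map e
  right_inv := map_map_symm e

theorem Iso.symm {G H : MGraph} (h : Iso G H) : Iso H G := by
  obtain ⟨e, he⟩ := h
  exact ⟨e.symm, fun x => by rw [← he, map_map_symm]⟩

instance setoid : Setoid MGraph where
  r := Iso
  iseqv :=
    { refl := fun G => ⟨Equiv.refl _, fun x => by simp⟩
      symm := Iso.symm
      trans := by
        rintro G H K ⟨e, he⟩ ⟨e', he'⟩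
        refine ⟨e.trans e', fun x => ?_⟩
        rw [← he x, ← he' (x.map e), Sym2.map_map]
        rfl }

/-- Number of edges `|H|`, with multiplicity and including loops. -/
def edges (H : MGraph) : ℕ := ∑ e, H.adj e

/-- Number of loops, with multiplicity: the trace of the adjacency matrix. -/
def loops (H : MGraph) : ℕ := ∑ i, H.adj s(i, i)

/-- `H! = ∏_{i ≤ j} H_{i,j}!`. -/
def fact (H : MGraph) : ℕ := ∏ e, (H.adj e).factorial

/-- `m_n^{[H]}(X)`: the sum of the distinct monomials `X^G`, where `G` runs over the graphs on `[n]`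
obtained by labeling the vertices of `H` by distinct elements of `[n]`
(for injective `φ`, `quot φ` only relabels the vertices and pads by zeros). -/
noncomputable def monoSum (H : MGraph) (n : ℕ) (X : SymMat n ℝ) : ℝ :=
  ∑ G ∈ (univ : Finset (Fin H.verts ↪ Fin n)).image (fun φ : Fin _ ↪ Fin n => quot (⇑φ) H.adj), monom G X

/-- The homomorphism number `hom(H; X)`. -/
def hom (H : MGraph) (n : ℕ) (X : SymMat n ℝ) : ℝ :=
  ∑ f : Fin H.verts → Fin n, ∏ e, X (e.map f) ^ H.adj e

/-- The injective homomorphism number `inj(H; X)`. -/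
noncomputable def inj (H : MGraph) (n : ℕ) (X : SymMat n ℝ) : ℝ :=
  ∑ f : Fin H.verts ↪ Fin n, ∏ e, X (e.map f) ^ H.adj e

/-- The surjections `f : V(G) → V(H)` with `G / P_f = H`. -/
def refinementMaps (G H : MGraph) : Set (Fin G.verts → Fin H.verts) :=
  {f | Function.Surjective f ∧ quot f G.adj = H.adj}

theorem Iso.verts_eq {G H : MGraph} (h : Iso G H) : G.verts = H.verts := by
  obtain ⟨e, -⟩ := h
  simpa using Fintype.card_congr e

theorem Iso.edges_eq {G H : MGraph} (h : Iso G H) : G.edges = H.edges := by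
  obtain ⟨e, he⟩ := h
  exact Fintype.sum_equiv (pairEquiv e) _ _ fun x => (he x).symm

theorem Iso.loops_eq {G H : MGraph} (h : Iso G H) : G.loops = H.loops := by
  obtain ⟨e, he⟩ := h
  exact Fintype.sum_equiv e _ _ fun i => (he s(i, i)).symm

theorem Iso.fact_eq {G H : MGraph} (h : Iso G H) : G.fact = H.fact := by
  obtain ⟨e, he⟩ := h
  exact Fintype.prod_equiv (pairEquiv e) _ _ fun x => by
    rw [← he x]; rfl

/-- Relabeling the source does not change quotients. -/
theorem quot_relabel {G H : MGraph} (e : Fin G.verts ≃ Fin H.verts)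
    (he : ∀ x, H.adj (x.map e) = G.adj x) {n : ℕ} (f : Fin G.verts → Fin n) :
    quot (f ∘ e.symm) H.adj = quot f G.adj := by
  funext y
  refine (Finset.sum_equiv (pairEquiv e) (fun x => ?_) fun x _ => (he x).symm).symm
  simp only [pairEquiv, mem_filter, mem_univ, true_and, Equiv.coe_fn_mk, Sym2.map_map]
  rw [show (f ∘ e.symm) ∘ e = f by ext; simp]

/-- Relabeling the target relabels quotients. -/
theorem quot_comp_equiv {R : Type*} [AddCommMonoid R] {n k l : ℕ} (f : Fin n → Fin k)
    (e : Fin k ≃ Fin l) (X : SymMat n R) (y : Sym2 (Fin k)) :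
    quot (e ∘ f) X (y.map e) = quot f X y := by
  unfold quot
  congr 1
  ext x
  simp only [mem_filter, mem_univ, true_and, ← Sym2.map_map]
  exact (pairEquiv e).injective.eq_iff

theorem Iso.monoSum_eq {G H : MGraph} (h : Iso G H) : G.monoSum = H.monoSum := by
  have key : ∀ {G H : MGraph}, Iso G H → ∀ n,
      (univ : Finset (Fin G.verts ↪ Fin n)).image (fun φ : Fin _ ↪ Fin n => quot (⇑φ) G.adj) ⊆
        (univ : Finset (Fin H.verts ↪ Fin n)).image (fun φ : Fin _ ↪ Fin n => quot (⇑φ) H.adj) := by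
    rintro G H ⟨e, he⟩ n K hK
    simp only [mem_image, mem_univ, true_and] at hK ⊢
    obtain ⟨φ, rfl⟩ := hK
    exact ⟨e.symm.toEmbedding.trans φ, quot_relabel e he φ⟩
  funext n X
  unfold monoSum
  rw [Finset.Subset.antisymm (key h n) (key h.symm n)]

theorem prod_relabel {G H : MGraph} (e : Fin G.verts ≃ Fin H.verts)
    (he : ∀ x, H.adj (x.map e) = G.adj x) {n : ℕ} (X : SymMat n ℝ) (f : Fin G.verts → Fin n) :
    ∏ x, X (x.map f) ^ G.adj x = ∏ x, X (x.map (f ∘ e.symm)) ^ H.adj x := by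
  refine Fintype.prod_equiv (pairEquiv e) _ _ fun x => ?_
  simp only [pairEquiv, Equiv.coe_fn_mk, he, Sym2.map_map]
  rw [show (f ∘ e.symm) ∘ e = f by ext; simp]

theorem Iso.hom_eq {G H : MGraph} (h : Iso G H) : G.hom = H.hom := by
  obtain ⟨e, he⟩ := h
  funext n X
  exact Fintype.sum_equiv (e.arrowCongr (Equiv.refl _)) _ _ fun f => prod_relabel e he X f

theorem Iso.inj_eq {G H : MGraph} (h : Iso G H) : G.inj = H.inj := by
  obtain ⟨e, he⟩ := h
  funext n X
  exact Fintype.sum_equiv (Equiv.embeddingCongr e (Equiv.refl _)) _ _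
    fun f => prod_relabel e he X f

theorem refinementMaps_card {G H G' H' : MGraph} (hG : Iso G G') (hH : Iso H H') :
    (refinementMaps G H).ncard = (refinementMaps G' H').ncard := by
  obtain ⟨e, he⟩ := hG
  obtain ⟨e', he'⟩ := hH
  refine Set.ncard_congr (fun f _ => e' ∘ f ∘ e.symm) ?_ ?_ ?_
  · rintro f ⟨hf, hq⟩
    refine ⟨e'.surjective.comp (hf.comp e.symm.surjective), ?_⟩
    funext y
    obtain ⟨x, rfl⟩ := (pairEquiv e').surjective y
    change quot (e' ∘ (f ∘ e.symm)) G'.adj (x.map e') = H'.adj (x.map e')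
    rw [quot_comp_equiv, quot_relabel e he, hq, he']
  · intro f g _ _ hfg
    funext x
    simpa using congrFun hfg (e x)
  · rintro f ⟨hf, hq⟩
    refine ⟨e'.symm ∘ f ∘ e, ⟨e'.symm.surjective.comp (hf.comp e.surjective), ?_⟩, ?_⟩
    · funext y
      have h1 : quot (f ∘ e) G.adj = quot f G'.adj := by
        rw [← quot_relabel e he (f ∘ e)]
        congr 1
        ext; simp
      rw [← quot_comp_equiv (e'.symm ∘ f ∘ e) e',
        show e' ∘ (e'.symm ∘ f ∘ e) = f ∘ e by ext; simp, h1, hq, he']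
    · ext; simp

theorem refinementMaps_nonempty {G H : MGraph} :
    (refinementMaps G H).Nonempty ↔ (refinementMaps G H).ncard ≠ 0 :=
  (Set.ncard_pos (Set.toFinite _)).symm.trans Nat.pos_iff_ne_zero

end MGraph

/-- Isomorphism classes `[H]` of graphs (isolated vertices having been removed). -/
def GraphClass := Quotient MGraph.setoid

namespace GraphClass

/-- `|V(H)|`. -/
def verts : GraphClass → ℕ := Quotient.lift MGraph.verts fun _ _ h => h.verts_eq

/-- `|H|`. -/
def edges : GraphClass → ℕ := Quotient.lift MGraph.edges fun _ _ h => h.edges_eq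

/-- The number of loops of `H`. -/
def loops : GraphClass → ℕ := Quotient.lift MGraph.loops fun _ _ h => h.loops_eq

/-- `H!`. -/
def fact : GraphClass → ℕ := Quotient.lift MGraph.fact fun _ _ h => h.fact_eq

/-- `m_n^{[H]}`. -/
noncomputable def monoSum : GraphClass → (n : ℕ) → SymMat n ℝ → ℝ :=
  Quotient.lift MGraph.monoSum fun _ _ h => h.monoSum_eq

/-- `hom(H; ·)`. -/
def hom : GraphClass → (n : ℕ) → SymMat n ℝ → ℝ :=
  Quotient.lift MGraph.hom fun _ _ h => h.hom_eq

/-- `inj(H; ·)`. -/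
noncomputable def inj : GraphClass → (n : ℕ) → SymMat n ℝ → ℝ :=
  Quotient.lift MGraph.inj fun _ _ h => h.inj_eq

/-- `R_{[G],[H]}`: the number of surjections `f : V(G) → V(H)` with `G / P_f = H`. -/
noncomputable def refCount : GraphClass → GraphClass → ℕ :=
  Quotient.lift₂ (fun G H => (MGraph.refinementMaps G H).ncard)
    fun _ _ _ _ hG hH => MGraph.refinementMaps_card hG hH

/-- `[G] ≤_R [H]`: there is a surjection `f : V(G) → V(H)` with `G / P_f = H`. -/
def Refines : GraphClass → GraphClass → Prop :=
  Quotient.lift₂ (fun G H => (MGraph.refinementMaps G H).Nonempty)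
    fun _ _ _ _ hG hH => by
      simp only [MGraph.refinementMaps_nonempty, MGraph.refinementMaps_card hG hH]

/-- `𝔼[m_k^{[H]}(X / P_F)]` for a uniformly random map `F : [n] → [k]`, where `X / P_F` is the
quotient graph. -/
noncomputable def quotExp (k : ℕ) (H : GraphClass) (n : ℕ) (X : SymMat n ℝ) : ℝ :=
  𝔼 F : Fin n → Fin k, H.monoSum k (quot F X)

/-- `𝔼[m_k^{[H]}(ρ(F)^⋆ X)]` for a uniformly random map `F : [n] → [k]`, where `ρ(F)^⋆ X = A X Aᵀ`
is the adjoint action on symmetric matrices. -/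
noncomputable def pushExp (k : ℕ) (H : GraphClass) (n : ℕ) (X : SymMat n ℝ) : ℝ :=
  𝔼 F : Fin n → Fin k, H.monoSum k (pushMat F X)

end GraphClass

/-- Freely-described polynomials of degree at most `d` over `Sym² 𝒵`: sequences `(p_n)` of
permutation-invariant polynomials of degree at most `d` on the spaces of symmetric `n × n`
matrices, each `p_N` restricting to `p_n` along zero-padding. -/
def freelyDescribed (d : ℕ) : Submodule ℝ ((n : ℕ) → SymMat n ℝ → ℝ) where
  carrier := {p |
    (∀ n, ∃ P : MvPolynomial (Sym2 (Fin n)) ℝ, P.totalDegree ≤ d ∧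
      ∀ X : SymMat n ℝ, p n X = MvPolynomial.eval X P) ∧
    (∀ n (σ : Equiv.Perm (Fin n)) (X : SymMat n ℝ), p n (permute σ X) = p n X) ∧
    ∀ n N, n ≤ N → ∀ X : SymMat n ℝ, p N (zeroPad X) = p n X}
  add_mem' := by
    rintro p q ⟨hp, hp', hp''⟩ ⟨hq, hq', hq''⟩
    refine ⟨fun n => ?_, fun n σ X => ?_, fun n N h X => ?_⟩
    · obtain ⟨P, hP, hPe⟩ := hp n
      obtain ⟨Q, hQ, hQe⟩ := hq n
      exact ⟨P + Q, (MvPolynomial.totalDegree_add P Q).trans (max_le hP hQ),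
        fun X => by simp [hPe, hQe]⟩
    · simp [hp', hq']
    · simp [hp'' n N h, hq'' n N h]
  zero_mem' := ⟨fun n => ⟨0, by simp, by simp⟩, by simp, by simp⟩
  smul_mem' := by
    rintro c p ⟨hp, hp', hp''⟩
    refine ⟨fun n => ?_, fun n σ X => ?_, fun n N h X => ?_⟩
    · obtain ⟨P, hP, hPe⟩ := hp n
      exact ⟨c • P, (MvPolynomial.totalDegree_smul_le c P).trans hP, fun X => by simp [hPe]⟩
    · simp [hp']
    · simp [hp'' n N h]

/-- The family `([H] ↦ (φ_n^{[H]})_n)`, with `[H]` ranging over the isomorphism classes of graphs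
with at most `d` edges, is a basis of the freely-described polynomials of degree at most `d`. -/
def IsFreeBasis (d : ℕ) (φ : GraphClass → (n : ℕ) → SymMat n ℝ → ℝ) : Prop :=
  ∃ b : Module.Basis {H : GraphClass // H.edges ≤ d} ℝ (freelyDescribed d),
    ∀ H, (b H : (n : ℕ) → SymMat n ℝ → ℝ) = φ H

/-!
The entries of a symmetric matrix over `ℕ` are the exponents of a monomial, and deleting the
isolated vertices attaches to each such matrix `K` on `[n]` an isomorphism class `graphClass K`.
Thus `m_n^{[H]}` is the sum of the monomials of class `[H]` (`GraphClass.monoSum_eq`), and everything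
is expressed through the `m_n^{[G]}`. The combinatorial fact used throughout is that a map
`f : V(G) → [n]` whose quotient is a labeling `ψ(H)` of `H` factors uniquely through `ψ`, since there
are no isolated vertices; so there are `R_{[G],[H]}` such maps (`MGraph.card_quot_eq`). At once
`inj(H; ·)` is `R_{[H],[H]}` times `m^{[H]}` and `hom(H; ·) = ∑ R_{[H],[G]} m^{[G]}`.

For the expectations, the multinomial theorem writes `X^K` at `X / P_F` as the sum of
`K!/G! · X^G` over the `G` with `G / P_F = K` (`monom_quot`). After interchanging the sums, the
coefficient of `X^G` is `H!/G!` times the probability that `G / P_F` has class `[H]`. That probability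
is found by counting in two ways the pairs of a map `F` and a labeling `ψ` of `H` with
`G / P_F = ψ(H)` (`GraphClass.card_quot_class_mul`). The variant with `ρ(F)^⋆` is reduced to this one:
`ρ(F)^⋆ X` is obtained by halving the diagonal of `X`, taking the quotient, and doubling the diagonal
(`pushMat_eq_scaleDiag`), and `m_n^{[G]}` is homogeneous of degree `ℓ(G)` in the diagonal.

For the bases, a freely-described polynomial is unchanged under relabeling and zero-padding along any
injection `[n] → [N]`, so the coefficient of `X^K` in it depends on the class of `K` only
(`GraphClass.exists_eq_sum_monoSum`); hence the `m^{[H]}` span, and they are independent because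
distinct monomials are. The other families are triangular with respect to the number of vertices,
as `R_{[G],[H]} ≠ 0` forces `|V(H)| < |V(G)|` unless `[G] = [H]`. Their diagonal coefficients are
nonzero; for the expectations this needs `|V(H)| ≤ 2|H| ≤ 2d ≤ k`.
-/

/-! ### Quotients of symmetric matrices -/

section Quot

variable {R : Type*} [AddCommMonoid R] {n k l : ℕ}

theorem quot_quot (f : Fin n → Fin k) (g : Fin k → Fin l) (X : SymMat n R) :
    quot g (quot f X) = quot (g ∘ f) X := by
  funext e
  unfold quot
  rw [← Finset.sum_fiberwise_of_maps_to (s := univ.filter fun e' => Sym2.map (g ∘ f) e' = e)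
    (t := univ.filter fun e' => Sym2.map g e' = e) (g := Sym2.map f)]
  · refine Finset.sum_congr rfl fun y hy => Finset.sum_congr ?_ fun _ _ => rfl
    ext x
    simp only [mem_filter, mem_univ, true_and] at hy ⊢
    rw [← Sym2.map_map]
    constructor
    · rintro rfl
      exact ⟨hy, rfl⟩
    · exact fun h => h.2
  · intro x hx
    simpa [Sym2.map_map] using hx

theorem sum_quot (f : Fin n → Fin k) (X : SymMat n R) : ∑ e, quot f X e = ∑ e, X e :=
  Finset.sum_fiberwise _ _ _

theorem quot_apply_map {f : Fin n → Fin k} (hf : Function.Injective f) (X : SymMat n R)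
    (e : Sym2 (Fin n)) : quot f X (e.map f) = X e := by
  refine Finset.sum_eq_single_of_mem e (by simp) fun x hx hne => ?_
  exact absurd (Sym2.map.injective hf (mem_filter.1 hx).2) hne

theorem quot_apply_eq_zero {f : Fin n → Fin k} (X : SymMat n R) {e : Sym2 (Fin k)}
    (h : ∀ e', Sym2.map f e' ≠ e) : quot f X e = 0 :=
  Finset.sum_eq_zero fun x hx => absurd (mem_filter.1 hx).2 (h x)

theorem quot_injective {f : Fin n → Fin k} (hf : Function.Injective f) :
    Function.Injective (quot (R := R) f) := fun X Y h => by
  funext e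
  rw [← quot_apply_map hf X, h, quot_apply_map hf]

@[simp] theorem quot_id (X : SymMat n R) : quot id X = X := by
  funext e
  rw [← quot_apply_map Function.injective_id X e, Sym2.map_id, id]

theorem permute_eq_quot (σ : Equiv.Perm (Fin n)) (X : SymMat n ℝ) : permute σ X = quot σ X := by
  funext e
  rw [← MGraph.map_map_symm σ e, quot_apply_map σ.injective]
  simp [permute, MGraph.map_symm_map]

theorem zeroPad_eq_quot {N : ℕ} (h : n ≤ N) (X : SymMat n ℝ) :
    zeroPad X = quot (Fin.castLE h) X := by
  funext e
  by_cases he : ∃ e', Sym2.map (Fin.castLE h) e' = e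
  · obtain ⟨e', rfl⟩ := he
    rw [quot_apply_map (Fin.castLE_injective h)]
    induction e' with | _ a b => simp [zeroPad]
  · push Not at he
    rw [quot_apply_eq_zero X he]
    induction e with | _ a b =>
    simp only [zeroPad, Sym2.lift_mk]
    rw [dif_neg]
    rintro ⟨ha, hb⟩
    exact he s(⟨a, ha⟩, ⟨b, hb⟩) rfl

/-- Every monomial in the entries pulled back along `f` is a monomial in the quotient exponent. -/
theorem prod_pow_quot {M : Type*} [CommMonoid M] (f : Fin n → Fin k) (K : SymMat n ℕ)
    (x : Sym2 (Fin k) → M) : ∏ e, x e ^ quot f K e = ∏ e, x (e.map f) ^ K e := by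
  simp only [quot, ← Finset.prod_pow_eq_pow_sum]
  rw [← Finset.prod_fiberwise univ (Sym2.map f)]
  refine Finset.prod_congr rfl fun e _ => Finset.prod_congr rfl fun x hx => ?_
  rw [(mem_filter.1 hx).2]

theorem prod_apply_quot_of_injective {M : Type*} [CommMonoid M] {f : Fin n → Fin k}
    (hf : Function.Injective f) (X : SymMat n R) {g : R → M} (hg : g 0 = 1) :
    ∏ e, g (quot f X e) = ∏ e, g (X e) := by
  refine (Fintype.prod_of_injective (Sym2.map f) (Sym2.map.injective hf) _ _ (fun e he => ?_)
    fun e => ?_).symm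
  · rw [quot_apply_eq_zero X fun e' h => he ⟨e', h⟩, hg]
  · rw [quot_apply_map hf]

theorem quot_ne_zero_iff {f : Fin n → Fin k} {K : SymMat n ℕ} {e : Sym2 (Fin k)} :
    quot f K e ≠ 0 ↔ ∃ e', e'.map f = e ∧ K e' ≠ 0 := by
  simp [quot, Finset.sum_eq_zero_iff]

end Quot

/-! ### Refinement maps -/

namespace MGraph

/-- The vertices met by an edge of `G / P_f` are exactly the images of vertices of `G`. -/
theorem mem_range_iff_quot {G : MGraph} {n : ℕ} (f : Fin G.verts → Fin n) (i : Fin n) :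
    i ∈ Set.range f ↔ ∃ j, quot f G.adj s(i, j) ≠ 0 := by
  simp only [quot_ne_zero_iff]
  constructor
  · rintro ⟨a, rfl⟩
    obtain ⟨b, hb⟩ := G.no_isolated a
    exact ⟨f b, s(a, b), rfl, hb⟩
  · rintro ⟨j, e, he, -⟩
    induction e with | _ a b =>
    rw [Sym2.map_mk, Sym2.eq_iff] at he
    rcases he with h | h
    · exact ⟨a, h.1⟩
    · exact ⟨b, h.2⟩

theorem range_eq_of_quot_eq {G H : MGraph} {n : ℕ} {f : Fin G.verts → Fin n}
    {g : Fin H.verts → Fin n} (h : quot f G.adj = quot g H.adj) : Set.range f = Set.range g := by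
  ext i
  rw [mem_range_iff_quot, mem_range_iff_quot, h]

/-- Absence of isolated vertices makes every map with quotient `H` surjective. -/
theorem mem_refinementMaps {G H : MGraph} {s : Fin G.verts → Fin H.verts} :
    s ∈ refinementMaps G H ↔ quot s G.adj = H.adj := by
  refine ⟨fun h => h.2, fun h => ⟨?_, h⟩⟩
  rw [← Set.range_eq_univ, range_eq_of_quot_eq (g := id) (by rw [h, quot_id]), Set.range_id]

/-- A map whose quotient is a labeling of `H` factors through the labeling. -/
theorem exists_factor {G H : MGraph} {n : ℕ} {f : Fin G.verts → Fin n}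
    {ψ : Fin H.verts → Fin n} (hψ : Function.Injective ψ) (h : quot f G.adj = quot ψ H.adj) :
    ∃ s ∈ refinementMaps G H, ψ ∘ s = f := by
  have hr := range_eq_of_quot_eq h
  have : ∀ a, ∃ b, ψ b = f a := fun a => by
    have : f a ∈ Set.range ψ := hr ▸ ⟨a, rfl⟩
    exact this
  choose s hs using this
  have hs' : ψ ∘ s = f := funext hs
  exact ⟨s, mem_refinementMaps.2 (quot_injective hψ (by rw [quot_quot, hs', h])), hs'⟩

open Classical in
/-- The maps whose quotient is a fixed labeling of `H` correspond to the refinement maps onto `H`,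
by composition with the labeling. -/
theorem card_quot_eq (G H : MGraph) {n : ℕ} {ψ : Fin H.verts → Fin n}
    (hψ : Function.Injective ψ) :
    #{f : Fin G.verts → Fin n | quot f G.adj = quot ψ H.adj} = (refinementMaps G H).ncard := by
  rw [← Set.ncard_coe_finset]
  refine (Set.ncard_congr (fun s _ => ψ ∘ s) ?_ ?_ ?_).symm
  · intro s hs
    simp [← quot_quot, hs.2]
  · intro s t _ _ hst
    exact funext fun a => hψ (congrFun hst a)
  · intro f hf
    obtain ⟨s, hs, rfl⟩ := exists_factor hψ (by simpa using hf)
    exact ⟨s, hs, rfl⟩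

theorem verts_le_of_mem_refinementMaps {G H : MGraph} {s : Fin G.verts → Fin H.verts}
    (hs : s ∈ refinementMaps G H) : H.verts ≤ G.verts := by
  simpa using Fintype.card_le_of_surjective s hs.1

/-- A refinement map between graphs of equal size is an isomorphism. -/
theorem iso_of_mem_refinementMaps {G H : MGraph} {s : Fin G.verts → Fin H.verts}
    (hs : s ∈ refinementMaps G H) (hv : G.verts ≤ H.verts) : Iso G H := by
  have hb : Function.Bijective s := by
    rw [Fintype.bijective_iff_surjective_and_card]
    exact ⟨hs.1, by simpa using le_antisymm hv (verts_le_of_mem_refinementMaps hs)⟩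
  refine ⟨Equiv.ofBijective s hb, fun x => ?_⟩
  rw [← hs.2]
  exact quot_apply_map hb.1 G.adj x

theorem mem_refinementMaps_id (G : MGraph) : id ∈ refinementMaps G G :=
  mem_refinementMaps.2 (quot_id _)

theorem iso_of_quot_eq {G H : MGraph} {n : ℕ} {φ : Fin G.verts → Fin n}
    {ψ : Fin H.verts → Fin n} (hφ : Function.Injective φ) (hψ : Function.Injective ψ)
    (h : quot φ G.adj = quot ψ H.adj) : Iso G H := by
  obtain ⟨s, hs, -⟩ := exists_factor hψ h
  obtain ⟨t, ht, -⟩ := exists_factor hφ h.symm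
  exact iso_of_mem_refinementMaps hs (verts_le_of_mem_refinementMaps ht)

/-- Removing the isolated vertices exhibits a matrix over `ℕ` as a labeling of a graph. -/
theorem exists_labeling {n : ℕ} (K : SymMat n ℕ) :
    ∃ (G : MGraph) (φ : Fin G.verts ↪ Fin n), quot φ G.adj = K := by
  classical
  let S : Finset (Fin n) := univ.filter fun i => ∃ j, K s(i, j) ≠ 0
  let φ : Fin #S ↪ Fin n := S.equivFin.symm.toEmbedding.trans (Function.Embedding.subtype _)
  have hφ : ∀ i j, K s(i, j) ≠ 0 → ∃ a, φ a = i := fun i j h =>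
    ⟨S.equivFin ⟨i, by simpa [S] using ⟨j, h⟩⟩, by simp [φ]⟩
  refine ⟨⟨#S, fun e => K (e.map φ), fun a => ?_⟩, φ, ?_⟩
  · have ha : φ a ∈ S := (S.equivFin.symm a).2
    obtain ⟨j, hj⟩ := (mem_filter.1 ha).2
    obtain ⟨b, rfl⟩ := hφ j (φ a) (by rwa [Sym2.eq_swap])
    exact ⟨b, hj⟩
  · funext e
    by_cases he : ∃ e', Sym2.map φ e' = e
    · obtain ⟨e', rfl⟩ := he
      exact quot_apply_map φ.injective _ _
    · push Not at he
      rw [quot_apply_eq_zero _ he]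
      induction e with | _ i j =>
      by_contra h
      obtain ⟨a, rfl⟩ := hφ i j (Ne.symm h)
      obtain ⟨b, rfl⟩ := hφ j (φ a) (by rw [Sym2.eq_swap]; exact Ne.symm h)
      exact he s(a, b) rfl

end MGraph

/-! ### The class of a labelled graph -/

/-- The isomorphism class of a graph. -/
def GraphClass.mk (G : MGraph) : GraphClass := Quotient.mk MGraph.setoid G

theorem GraphClass.exists_mk (H : GraphClass) : ∃ G, GraphClass.mk G = H := Quotient.exists_rep H

theorem GraphClass.mk_eq_mk {G H : MGraph} : GraphClass.mk G = GraphClass.mk H ↔ MGraph.Iso G H :=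
  Quotient.eq (r := MGraph.setoid)

/-- The isomorphism class of the graph on `[n]` with adjacency matrix `K`, its isolated vertices
being removed. -/
noncomputable def graphClass {n : ℕ} (K : SymMat n ℕ) : GraphClass :=
  .mk (MGraph.exists_labeling K).choose

theorem graphClass_quot (G : MGraph) {n : ℕ} {φ : Fin G.verts → Fin n}
    (hφ : Function.Injective φ) :
    graphClass (quot φ G.adj) = GraphClass.mk G := by
  obtain ⟨ψ, hψ⟩ := (MGraph.exists_labeling (quot φ G.adj)).choose_spec
  exact GraphClass.mk_eq_mk.2 (MGraph.iso_of_quot_eq ψ.injective hφ hψ)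

theorem graphClass_adj (G : MGraph) : graphClass G.adj = GraphClass.mk G := by
  simpa using graphClass_quot G Function.injective_id

theorem graphClass_eq_iff {G : MGraph} {n : ℕ} {K : SymMat n ℕ} :
    graphClass K = GraphClass.mk G ↔
      ∃ φ : Fin G.verts ↪ Fin n, quot φ G.adj = K := by
  constructor
  · intro h
    obtain ⟨G', φ, rfl⟩ := MGraph.exists_labeling K
    rw [graphClass_quot G' φ.injective] at h
    obtain ⟨e, he⟩ : MGraph.Iso G' G := GraphClass.mk_eq_mk.1 h
    exact ⟨e.symm.toEmbedding.trans φ, MGraph.quot_relabel e he φ⟩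
  · rintro ⟨φ, rfl⟩
    exact graphClass_quot G φ.injective

theorem graphClass_quot_of_injective {n k : ℕ} {f : Fin n → Fin k} (hf : Function.Injective f)
    (K : SymMat n ℕ) : graphClass (quot f K) = graphClass K := by
  obtain ⟨G, φ, rfl⟩ := MGraph.exists_labeling K
  rw [quot_quot, graphClass_quot G (hf.comp φ.injective), graphClass_quot G φ.injective]

theorem edges_graphClass {n : ℕ} (K : SymMat n ℕ) : (graphClass K).edges = ∑ e, K e := by
  obtain ⟨G, φ, rfl⟩ := MGraph.exists_labeling K
  rw [graphClass_quot G φ.injective, sum_quot]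
  rfl

theorem fact_graphClass {n : ℕ} (K : SymMat n ℕ) :
    (graphClass K).fact = ∏ e, (K e).factorial := by
  obtain ⟨G, φ, rfl⟩ := MGraph.exists_labeling K
  rw [graphClass_quot G φ.injective, prod_apply_quot_of_injective φ.injective _ rfl]
  rfl

namespace GraphClass

theorem fact_ne_zero (H : GraphClass) : H.fact ≠ 0 := by
  obtain ⟨G, rfl⟩ := H.exists_mk
  change ∏ e, (G.adj e).factorial ≠ 0
  exact Finset.prod_ne_zero_iff.2 fun _ _ => Nat.factorial_ne_zero _

theorem refines_iff {G H : GraphClass} : G.Refines H ↔ G.refCount H ≠ 0 := by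
  obtain ⟨G, rfl⟩ := G.exists_mk
  obtain ⟨H, rfl⟩ := H.exists_mk
  exact MGraph.refinementMaps_nonempty

theorem verts_lt_of_refCount_ne_zero {G H : GraphClass} (h : G.refCount H ≠ 0) (hne : G ≠ H) :
    H.verts < G.verts := by
  obtain ⟨G, rfl⟩ := G.exists_mk
  obtain ⟨H, rfl⟩ := H.exists_mk
  obtain ⟨s, hs⟩ := MGraph.refinementMaps_nonempty.2 h
  by_contra hv
  exact hne (GraphClass.mk_eq_mk.2 (MGraph.iso_of_mem_refinementMaps hs (not_lt.1 hv)))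

theorem edges_eq_of_refCount_ne_zero {G H : GraphClass} (h : G.refCount H ≠ 0) :
    G.edges = H.edges := by
  obtain ⟨G, rfl⟩ := G.exists_mk
  obtain ⟨H, rfl⟩ := H.exists_mk
  obtain ⟨s, hs⟩ := MGraph.refinementMaps_nonempty.2 h
  change ∑ e, G.adj e = ∑ e, H.adj e
  rw [← hs.2, sum_quot]

theorem refCount_self_ne_zero (H : GraphClass) : H.refCount H ≠ 0 := by
  obtain ⟨H, rfl⟩ := H.exists_mk
  exact MGraph.refinementMaps_nonempty.1 ⟨id, MGraph.mem_refinementMaps_id H⟩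

open Classical in
/-- The adjacency matrices of the graphs on `[n]` of class `H`. -/
noncomputable def labelings (H : GraphClass) (n : ℕ) : Finset (SymMat n ℕ) :=
  {K ∈ piAntidiag univ H.edges | graphClass K = H}

theorem mem_labelings {H : GraphClass} {n : ℕ} {K : SymMat n ℕ} :
    K ∈ H.labelings n ↔ graphClass K = H := by
  simp only [labelings, mem_filter, mem_piAntidiag, mem_univ, implies_true, and_true,
    and_iff_right_iff_imp]
  rintro rfl
  exact (edges_graphClass K).symm

theorem monoSum_eq (H : GraphClass) (n : ℕ) (X : SymMat n ℝ) :
    H.monoSum n X = ∑ K ∈ H.labelings n, monom K X := by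
  obtain ⟨H, rfl⟩ := H.exists_mk
  refine Finset.sum_congr ?_ fun _ _ => rfl
  ext K
  rw [mem_labelings, graphClass_eq_iff]
  simp

open Classical in
/-- Each labelled graph of class `H` arises from as many embeddings as `H` has automorphisms. -/
theorem card_embeddings (H : MGraph) {n : ℕ} (K : SymMat n ℕ) :
    #{ψ : Fin H.verts ↪ Fin n | quot ψ H.adj = K} =
      if graphClass K = GraphClass.mk H then (MGraph.refinementMaps H H).ncard
      else 0 := by
  split_ifs with h
  · obtain ⟨φ, rfl⟩ := graphClass_eq_iff.1 h
    rw [← MGraph.card_quot_eq H H φ.injective]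
    refine Finset.card_bij (fun ψ _ => ψ) (by simp) (fun _ _ _ _ h => DFunLike.coe_injective h)
      fun f hf => ?_
    obtain ⟨s, hs, rfl⟩ := MGraph.exists_factor φ.injective (by simpa using hf)
    exact ⟨⟨_, φ.injective.comp (Finite.injective_iff_surjective.2 hs.1)⟩, by simpa using hf, rfl⟩
  · rw [Finset.card_eq_zero, Finset.filter_eq_empty_iff]
    exact fun ψ _ hψ => h (graphClass_eq_iff.2 ⟨ψ, hψ⟩)

/-- Injective homomorphisms count every labeling once for each automorphism. -/
theorem inj_eq (H : GraphClass) (n : ℕ) (X : SymMat n ℝ) :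
    H.inj n X = H.refCount H * H.monoSum n X := by
  classical
  rw [monoSum_eq, Finset.mul_sum]
  obtain ⟨H, rfl⟩ := H.exists_mk
  change ∑ f : Fin H.verts ↪ Fin n, ∏ e, X (e.map f) ^ H.adj e = _
  simp_rw [← prod_pow_quot]
  rw [← Finset.sum_fiberwise_of_maps_to (s := univ) (t := labelings (mk H) n)
    (g := fun φ : Fin H.verts ↪ Fin n => quot φ H.adj)
    fun φ _ => mem_labelings.2 (graphClass_quot H φ.injective)]
  refine Finset.sum_congr rfl fun K hK => ?_
  rw [Finset.sum_congr rfl (g := fun _ => monom K X) fun φ hφ => by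
    rw [(mem_filter.1 hφ).2]; rfl, Finset.sum_const, card_embeddings,
    if_pos (mem_labelings.1 hK), nsmul_eq_mul]
  rfl

/-! ### Collecting labelled graphs by class -/

open Classical in
/-- The adjacency matrices of the graphs on `[n]` whose class lies in `T`. -/
noncomputable def labelingsOf (T : Finset GraphClass) (n : ℕ) : Finset (SymMat n ℕ) :=
  T.biUnion fun H => H.labelings n

theorem mem_labelingsOf {T : Finset GraphClass} {n : ℕ} {K : SymMat n ℕ} :
    K ∈ labelingsOf T n ↔ graphClass K ∈ T := by
  simp [labelingsOf, mem_labelings]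

theorem sum_labelingsOf (T : Finset GraphClass) (c : GraphClass → ℝ) (n : ℕ) (X : SymMat n ℝ) :
    ∑ K ∈ labelingsOf T n, c (graphClass K) * monom K X = ∑ G ∈ T, c G * G.monoSum n X := by
  classical
  rw [← Finset.sum_fiberwise_of_maps_to (g := graphClass) (t := T) fun K => mem_labelingsOf.1]
  refine Finset.sum_congr rfl fun G hG => ?_
  rw [monoSum_eq, Finset.mul_sum]
  refine Finset.sum_congr ?_ fun K hK => by rw [mem_labelings.1 hK]
  ext K
  rw [mem_filter, mem_labelingsOf, mem_labelings]
  exact ⟨fun h => h.2, fun h => ⟨h ▸ hG, h⟩⟩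

/-- Homomorphism numbers in terms of the `m_n^{[G]}`: the coefficient of `X^K` in `hom(H; X)` is the
number of maps with quotient `K`, which is the refinement number from `H` to the class of `K`. -/
theorem hom_eq {T : Finset GraphClass} {H : GraphClass} (hT : ∀ G, H.refCount G ≠ 0 → G ∈ T)
    (n : ℕ) (X : SymMat n ℝ) :
    H.hom n X = ∑ G ∈ T, H.refCount G * G.monoSum n X := by
  classical
  rw [← sum_labelingsOf T (fun G => H.refCount G)]
  obtain ⟨H, rfl⟩ := H.exists_mk
  have hcard : ∀ K : SymMat n ℕ, #{f : Fin H.verts → Fin n | quot f H.adj = K} =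
      refCount (mk H) (graphClass K) := by
    intro K
    obtain ⟨G, φ, rfl⟩ := MGraph.exists_labeling K
    rw [MGraph.card_quot_eq H G φ.injective, graphClass_quot G φ.injective]
    rfl
  change ∑ f : Fin H.verts → Fin n, ∏ e, X (e.map f) ^ H.adj e = _
  simp_rw [← prod_pow_quot]
  rw [← Finset.sum_fiberwise_of_maps_to (s := univ) (t := labelingsOf T n)
    (g := fun f : Fin H.verts → Fin n => quot f H.adj) fun f _ => mem_labelingsOf.2 (hT _ ?_)]
  · refine Finset.sum_congr rfl fun K hK => ?_
    rw [Finset.sum_congr rfl (g := fun _ => monom K X) fun f hf => by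
      rw [(mem_filter.1 hf).2]; rfl, Finset.sum_const, hcard, nsmul_eq_mul]
  · rw [← hcard, Ne, Finset.card_eq_zero, ← Ne, ← Finset.nonempty_iff_ne_empty]
    exact ⟨f, by simp⟩

end GraphClass

/-! ### Monomials of a quotient -/

/-- A product over `b` of powers of the fiber sums of `π`, expanded by the multinomial theorem in
every fiber: the exponents `G` on the source that occur are those with fiber sums `K`. -/
theorem prod_sum_fiber_pow {α β : Type*} [Fintype α] [Fintype β] [DecidableEq α] [DecidableEq β]
    (π : α → β) (x : α → ℝ) (K : β → ℕ) :
    ∏ b, (∑ a with π a = b, x a) ^ K b =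
      ∑ G ∈ piAntidiag univ (∑ b, K b) with (fun b => ∑ a with π a = b, G a) = K,
        ((∏ b, (K b).factorial : ℕ) / (∏ a, (G a).factorial : ℕ) : ℝ) * ∏ a, x a ^ G a := by
  simp_rw [Finset.sum_pow_eq_sum_piAntidiag]
  rw [Finset.prod_univ_sum]
  refine Finset.sum_bij' (fun p _ a => p (π a) a) (fun G _ b a => if π a = b then G a else 0)
    ?_ ?_ ?_ ?_ ?_
  · intro p hp
    simp only [Fintype.mem_piFinset, mem_piAntidiag, mem_filter, mem_univ, true_and] at hp
    have key : (fun b => ∑ a with π a = b, p (π a) a) = K := by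
      funext b
      rw [← (hp b).1]
      exact Finset.sum_congr rfl fun a ha => by rw [(mem_filter.1 ha).2]
    simp only [mem_filter, mem_piAntidiag, mem_univ, implies_true, and_true]
    refine ⟨?_, key⟩
    rw [← Finset.sum_fiberwise univ π]
    exact Finset.sum_congr rfl fun b _ => congrFun key b
  · intro G hG
    simp only [mem_filter, mem_piAntidiag, mem_univ, implies_true, and_true] at hG
    simp only [Fintype.mem_piFinset, mem_piAntidiag, mem_filter, mem_univ, true_and]
    intro b
    refine ⟨?_, fun a => by simp +contextual⟩
    rw [← congrFun hG.2 b]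
    exact Finset.sum_congr rfl fun a ha => if_pos (mem_filter.1 ha).2
  · intro p hp
    simp only [Fintype.mem_piFinset, mem_piAntidiag, mem_filter, mem_univ, true_and] at hp
    funext b a
    by_cases h : π a = b
    · simp [h]
    · simp only [h, if_false]
      by_contra h0
      exact h ((hp b).2 a (Ne.symm h0))
  · intro G hG
    simp
  · intro p hp
    simp only [Fintype.mem_piFinset, mem_piAntidiag, mem_filter, mem_univ, true_and] at hp
    have hm : ∀ b, (Nat.multinomial (univ.filter fun a => π a = b) (p b) : ℝ) =
        (K b).factorial / ∏ a with π a = b, ((p (π a) a).factorial : ℝ) := by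
      intro b
      have h := Nat.multinomial_spec (univ.filter fun a => π a = b) (p b)
      rw [(hp b).1] at h
      have h' : ∏ a with π a = b, ((p (π a) a).factorial : ℝ) =
          ∏ a with π a = b, ((p b a).factorial : ℝ) :=
        Finset.prod_congr rfl fun a ha => by rw [(mem_filter.1 ha).2]
      rw [h', eq_div_iff (Finset.prod_ne_zero_iff.2 fun a _ => by positivity), mul_comm, ← h]
      push_cast
      rfl
    rw [Finset.prod_mul_distrib]
    simp_rw [hm]
    rw [Finset.prod_div_distrib, Finset.prod_fiberwise univ π
      (fun a => ((p (π a) a).factorial : ℝ)), ← Finset.prod_fiberwise univ π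
      (fun a => x a ^ p (π a) a)]
    push_cast
    congr 1
    refine Finset.prod_congr rfl fun b _ => Finset.prod_congr rfl fun a ha => ?_
    rw [(mem_filter.1 ha).2]

/-- A monomial evaluated at `X / P_F` is the weighted sum of the monomials with quotient `K`. -/
theorem monom_quot {n k : ℕ} (F : Fin n → Fin k) (X : SymMat n ℝ) (K : SymMat k ℕ) :
    monom K (quot F X) = ∑ G ∈ piAntidiag univ (∑ e, K e) with quot F G = K,
      ((graphClass K).fact / (graphClass G).fact : ℝ) * monom G X := by
  simp_rw [fact_graphClass]
  exact prod_sum_fiber_pow (Sym2.map F) X K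

namespace GraphClass

open Classical in
/-- The labelled graphs occurring in `m_k^{[H]}(X / P_F)` are those whose quotient has class `H`. -/
theorem monoSum_quot (H : GraphClass) {n k : ℕ} (F : Fin n → Fin k) (X : SymMat n ℝ) :
    H.monoSum k (quot F X) =
      ∑ G ∈ piAntidiag univ H.edges with graphClass (quot F G) = H,
        (H.fact / (graphClass G).fact : ℝ) * monom G X := by
  rw [monoSum_eq, ← Finset.sum_fiberwise_of_maps_to
    (s := (piAntidiag univ H.edges).filter fun G => graphClass (quot F G) = H)
    (t := H.labelings k) (g := quot F)
    fun G hG => mem_labelings.2 (mem_filter.1 hG).2]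
  refine Finset.sum_congr rfl fun K hK => ?_
  rw [mem_labelings] at hK
  subst hK
  rw [monom_quot, Finset.filter_filter, edges_graphClass]
  refine Finset.sum_congr (Finset.filter_congr fun G _ => ?_) fun _ _ => rfl
  exact ⟨fun h => ⟨by rw [h], h⟩, fun h => h.2⟩

/-- Relabeling vertices and zero-padding do not change `m_n^{[H]}`. -/
theorem monoSum_quot_of_injective (H : GraphClass) {n k : ℕ} {f : Fin n → Fin k}
    (hf : Function.Injective f) (X : SymMat n ℝ) : H.monoSum k (quot f X) = H.monoSum n X := by
  classical
  rw [monoSum_quot, monoSum_eq, labelings]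
  simp_rw [graphClass_quot_of_injective hf]
  refine Finset.sum_congr rfl fun G hG => ?_
  rw [(mem_filter.1 hG).2, div_self (Nat.cast_ne_zero.2 H.fact_ne_zero), one_mul]

/-! ### The law of a random quotient -/

open Classical in
/-- Double counting of the pairs of a map `F` and a labeling `ψ` of `H` with `G / P_F = ψ(H)`. -/
theorem card_quot_class_mul (G H : MGraph) (k : ℕ) :
    #{F : Fin G.verts → Fin k | graphClass (quot F G.adj) = mk H} * (mk H).refCount (mk H) =
      k.descFactorial H.verts * (mk G).refCount (mk H) := by
  have h1 : ∑ ψ : Fin H.verts ↪ Fin k,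
      #{F : Fin G.verts → Fin k | quot F G.adj = quot ψ H.adj} =
        k.descFactorial H.verts * (mk G).refCount (mk H) := by
    simp_rw [fun ψ : Fin H.verts ↪ Fin k => MGraph.card_quot_eq G H ψ.injective]
    rw [Finset.sum_const, Finset.card_univ, Fintype.card_embedding_eq, Fintype.card_fin,
      Fintype.card_fin, smul_eq_mul]
    rfl
  have h2 := Finset.sum_card_bipartiteAbove_eq_sum_card_bipartiteBelow
    (s := (univ : Finset (Fin H.verts ↪ Fin k))) (t := (univ : Finset (Fin G.verts → Fin k)))
    fun (ψ : Fin H.verts ↪ Fin k) F => quot F G.adj = quot ψ H.adj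
  simp only [bipartiteAbove, bipartiteBelow] at h2
  rw [← h1, h2]
  simp_rw [eq_comm (a := quot _ G.adj), card_embeddings]
  rw [← Finset.sum_filter, Finset.sum_const, smul_eq_mul]
  rfl

/-- The restriction of a uniformly random map along an embedding is uniformly random. -/
theorem card_filter_comp {m n k : ℕ} (φ : Fin m ↪ Fin n) (P : (Fin m → Fin k) → Prop)
    [DecidablePred P] :
    #{F : Fin n → Fin k | P (F ∘ φ)} * k ^ m = #{F : Fin m → Fin k | P F} * k ^ n := by
  classical
  let e : Fin m ⊕ {i // i ∉ Set.range φ} ≃ Fin n :=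
    ((Equiv.ofInjective φ φ.injective).sumCongr (Equiv.refl _)).trans
      (Equiv.Set.sumCompl (Set.range φ))
  let E : (Fin n → Fin k) ≃ (Fin m → Fin k) × ({i // i ∉ Set.range φ} → Fin k) :=
    (e.arrowCongr (Equiv.refl _)).symm.trans (Equiv.sumArrowEquivProdArrow _ _ _)
  have hE : ∀ F, (E F).1 = F ∘ φ := fun F => rfl
  have hn : m + Fintype.card {i // i ∉ Set.range φ} = n := by
    simpa using Fintype.card_congr e
  have hc : #{F : Fin n → Fin k | P (F ∘ φ)} =
      #((univ.filter P) ×ˢ (univ : Finset ({i // i ∉ Set.range φ} → Fin k))) := by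
    refine Finset.card_equiv E fun F => ?_
    simp [hE]
  rw [hc, Finset.card_product, Finset.card_univ, Fintype.card_fun, Fintype.card_fin, mul_assoc,
    ← pow_add, add_comm, hn]

open Classical in
/-- The probability that a uniformly random quotient of the labelled graph `K` has class `H`. -/
theorem card_quot_class_div {n k : ℕ} (hk : 0 < k) (K : SymMat n ℕ) (H : GraphClass) :
    (#{F : Fin n → Fin k | graphClass (quot F K) = H} : ℝ) / k ^ n =
      (k.descFactorial H.verts : ℝ) / (k : ℝ) ^ (graphClass K).verts *
        (((graphClass K).refCount H : ℝ) / H.refCount H) := by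
  obtain ⟨H, rfl⟩ := H.exists_mk
  obtain ⟨G, φ, rfl⟩ := MGraph.exists_labeling K
  rw [graphClass_quot G φ.injective]
  have h1 := card_filter_comp (k := k) φ fun F => graphClass (quot F G.adj) = mk H
  have h2 := card_quot_class_mul G H k
  simp_rw [quot_quot]
  have hR : ((mk H).refCount (mk H) : ℝ) ≠ 0 := by exact_mod_cast refCount_self_ne_zero _
  have hk' : (k : ℝ) ≠ 0 := by positivity
  have hv : (mk G).verts = G.verts := rfl
  have hv' : (mk H).verts = H.verts := rfl
  rw [hv, hv', div_mul_div_comm, div_eq_div_iff (by positivity)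
    (mul_ne_zero (by positivity) hR)]
  have h1' : (#{F : Fin n → Fin k | graphClass (quot (F ∘ φ) G.adj) = mk H} : ℝ) * k ^ G.verts =
    #{F : Fin G.verts → Fin k | graphClass (quot F G.adj) = mk H} * k ^ n := by exact_mod_cast h1
  have h2' : (#{F : Fin G.verts → Fin k | graphClass (quot F G.adj) = mk H} : ℝ) *
    (mk H).refCount (mk H) = k.descFactorial H.verts * (mk G).refCount (mk H) := by
    exact_mod_cast h2
  rw [← mul_assoc, h1', mul_right_comm, h2']

/-- The coefficient of `m_n^{[G]}` in the expansion of `p_n^{(k,[H])}`. -/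
noncomputable def quotCoeff (k : ℕ) (H G : GraphClass) : ℝ :=
  ((H.fact : ℝ) / G.fact) * ((k.descFactorial H.verts : ℝ) / (k : ℝ) ^ G.verts) *
    ((G.refCount H : ℝ) / H.refCount H)

theorem refCount_ne_zero_of_quotCoeff {k : ℕ} {H G : GraphClass} (h : quotCoeff k H G ≠ 0) :
    G.refCount H ≠ 0 := by
  rintro h0
  simp [quotCoeff, h0] at h

/-- `p_n^{(k,[H])}` as a combination of the `m_n^{[G]}`: interchange the expectation with the
expansion of `m_k^{[H]}` at a quotient. -/
theorem quotExp_eq {k : ℕ} (hk : 0 < k) {H : GraphClass} {T : Finset GraphClass}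
    (hT : ∀ G, G.refCount H ≠ 0 → G ∈ T) (n : ℕ) (X : SymMat n ℝ) :
    H.quotExp k n X = ∑ G ∈ T, quotCoeff k H G * G.monoSum n X := by
  classical
  rw [← sum_labelingsOf T (quotCoeff k H)]
  rw [quotExp, Fintype.expect_eq_sum_div_card]
  simp_rw [monoSum_quot, Finset.sum_filter]
  rw [Finset.sum_comm, Finset.sum_div]
  have hterm : ∀ K : SymMat n ℕ, (∑ F : Fin n → Fin k, if graphClass (quot F K) = H then
      (H.fact / (graphClass K).fact : ℝ) * monom K X else 0) /
        Fintype.card (Fin n → Fin k) = quotCoeff k H (graphClass K) * monom K X := by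
    intro K
    rw [← Finset.sum_filter, Finset.sum_const, nsmul_eq_mul, Fintype.card_fun, Fintype.card_fin,
      Fintype.card_fin, mul_div_right_comm, Nat.cast_pow, card_quot_class_div hk, quotCoeff]
    ring
  rw [Finset.sum_congr rfl fun K _ => hterm K]
  -- Both index sets may be cut down to the labelled graphs whose class refines `H`.
  rw [← Finset.sum_filter_of_ne (p := fun K => (graphClass K).refCount H ≠ 0)
      (s := piAntidiag univ H.edges)
      fun K _ h => refCount_ne_zero_of_quotCoeff (left_ne_zero_of_mul h),
    ← Finset.sum_filter_of_ne (p := fun K => (graphClass K).refCount H ≠ 0)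
      (s := labelingsOf T n)
      fun K _ h => refCount_ne_zero_of_quotCoeff (left_ne_zero_of_mul h)]
  refine Finset.sum_congr ?_ fun _ _ => rfl
  ext K
  simp only [mem_filter, mem_piAntidiag, mem_univ, implies_true, and_true, mem_labelingsOf]
  refine and_congr_left fun h => ⟨fun _ => hT _ h, fun _ => ?_⟩
  rw [← edges_graphClass, edges_eq_of_refCount_ne_zero h]

end GraphClass

/-! ### The action `ρ(f)^⋆` as a quotient with rescaled loops -/

/-- Multiplication of the diagonal entries by `c`. -/
def scaleDiag {n : ℕ} (c : ℝ) (X : SymMat n ℝ) : SymMat n ℝ :=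
  fun e => (if e.IsDiag then c else 1) * X e

/-- Off-diagonal unordered pairs arise from two ordered pairs, diagonal ones from one. -/
theorem sum_sum_sym2 {n : ℕ} {M : Type*} [AddCommMonoid M] (g : Sym2 (Fin n) → M) :
    ∑ a, ∑ b, g s(a, b) = ∑ e, (if e.IsDiag then 1 else 2) • g e := by
  rw [← Fintype.sum_prod_type', ← Finset.sum_fiberwise univ (fun p : Fin n × Fin n => s(p.1, p.2))]
  refine Finset.sum_congr rfl fun e _ => ?_
  rw [Finset.sum_congr rfl (g := fun _ => g e) fun p hp => by rw [(mem_filter.1 hp).2],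
    Finset.sum_const]
  congr 1
  induction e with | _ a b =>
  have : ({p : Fin n × Fin n | s(p.1, p.2) = s(a, b)} : Finset _) = {(a, b), (b, a)} := by
    ext ⟨c, d⟩
    simp
  rw [this]
  by_cases h : a = b
  · simp [h]
  · rw [if_neg (by simpa using h)]
    exact Finset.card_pair fun h' => h (congrArg Prod.fst h')

/-- Halving the loops before the quotient and doubling them after it leaves the loops of `X` with
weight one and gives weight two to the collapsed edges. -/
theorem pushMat_eq_scaleDiag {n k : ℕ} (f : Fin n → Fin k) (X : SymMat n ℝ) :
    pushMat f X = scaleDiag 2 (quot f (scaleDiag 2⁻¹ X)) := by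
  funext e
  have h := sum_sum_sym2 fun x => if Sym2.map f x = e then X x else 0
  have hr : ∑ x : Sym2 (Fin n), (if x.IsDiag then 1 else 2) • (if Sym2.map f x = e then X x else 0)
      = 2 * quot f (scaleDiag 2⁻¹ X) e := by
    rw [quot, Finset.sum_filter, Finset.mul_sum]
    refine Finset.sum_congr rfl fun x _ => ?_
    by_cases hx : x.IsDiag <;> by_cases hx' : Sym2.map f x = e <;> simp [hx, hx', scaleDiag]
  rw [hr] at h
  induction e with | _ i j =>
  have hp : ∀ i j : Fin k, pushMat f X s(i, j) =
      ∑ a, ∑ b, if f a = i ∧ f b = j then X s(a, b) else 0 := by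
    intro i j
    simp only [pushMat, Sym2.lift_mk, Finset.sum_filter]
    refine Finset.sum_congr rfl fun a _ => ?_
    by_cases ha : f a = i <;> simp [ha]
  simp only [Sym2.map_mk, Sym2.eq_iff] at h
  rw [scaleDiag]
  by_cases hij : i = j
  · subst hij
    rw [if_pos (by simp), ← h, hp]
    simp
  · -- The two orders of an off-diagonal pair contribute equally, so both sides are doubled.
    rw [if_neg (by simpa using hij), one_mul]
    have h2 : 2 * pushMat f X s(i, j) = 2 * quot f (scaleDiag 2⁻¹ X) s(i, j) := by
      rw [← h, two_mul]
      nth_rw 2 [Sym2.eq_swap]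
      rw [hp, hp, ← Finset.sum_add_distrib]
      refine Finset.sum_congr rfl fun a _ => ?_
      rw [← Finset.sum_add_distrib]
      refine Finset.sum_congr rfl fun b _ => ?_
      by_cases h1 : f a = i <;> by_cases h2 : f b = j <;> by_cases h3 : f a = j <;>
        by_cases h4 : f b = i <;> simp_all
    linarith

namespace GraphClass

/-- `m_n^{[H]}` is homogeneous of degree the number of loops of `H` in the diagonal entries. -/
theorem monoSum_scaleDiag (H : GraphClass) {n : ℕ} (c : ℝ) (X : SymMat n ℝ) :
    H.monoSum n (scaleDiag c X) = c ^ H.loops * H.monoSum n X := by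
  rw [monoSum_eq, monoSum_eq, Finset.mul_sum]
  refine Finset.sum_congr rfl fun K hK => ?_
  obtain ⟨H, rfl⟩ := H.exists_mk
  obtain ⟨φ, rfl⟩ := graphClass_eq_iff.1 (mem_labelings.1 hK)
  simp only [monom, scaleDiag, mul_pow, Finset.prod_mul_distrib]
  congr 1
  rw [prod_pow_quot φ H.adj fun e => if e.IsDiag then c else 1]
  simp only [Sym2.isDiag_map φ.injective]
  change _ = c ^ ∑ i, H.adj s(i, i)
  rw [← Finset.prod_pow_eq_pow_sum]
  refine (Fintype.prod_of_injective (fun i => s(i, i)) (fun i j h => by simpa using h) _ _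
    (fun e he => ?_) fun i => by simp).symm
  rw [if_neg, one_pow]
  intro h
  induction e with | _ a b =>
  rw [Sym2.mk_isDiag_iff] at h
  exact he ⟨a, by simp [h]⟩

theorem pushExp_eq {k : ℕ} (hk : 0 < k) {H : GraphClass} {T : Finset GraphClass}
    (hT : ∀ G, G.refCount H ≠ 0 → G ∈ T) (n : ℕ) (X : SymMat n ℝ) :
    H.pushExp k n X =
      ∑ G ∈ T, (2 : ℝ) ^ (H.loops - G.loops : ℤ) * quotCoeff k H G * G.monoSum n X := by
  have h : H.pushExp k n X = 2 ^ H.loops * H.quotExp k n (scaleDiag 2⁻¹ X) := by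
    simp_rw [pushExp, pushMat_eq_scaleDiag, monoSum_scaleDiag, quotExp, Finset.mul_expect]
  rw [h, quotExp_eq hk hT, Finset.mul_sum]
  refine Finset.sum_congr rfl fun G _ => ?_
  rw [monoSum_scaleDiag, zpow_sub₀ two_ne_zero, zpow_natCast, zpow_natCast, inv_pow]
  ring

end GraphClass

/-! ### Finiteness of the set of classes -/

namespace GraphClass

/-- Every vertex meets an edge and every edge meets at most two vertices. -/
theorem verts_le_two_mul_edges (H : GraphClass) : H.verts ≤ 2 * H.edges := by
  obtain ⟨H, rfl⟩ := H.exists_mk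
  change H.verts ≤ 2 * ∑ e, H.adj e
  calc H.verts = ∑ _i : Fin H.verts, 1 := by simp
    _ ≤ ∑ i, ∑ j, H.adj s(i, j) := Finset.sum_le_sum fun i _ => by
        obtain ⟨j, hj⟩ := H.no_isolated i
        exact (Nat.one_le_iff_ne_zero.2 hj).trans
          (Finset.single_le_sum (f := fun j => H.adj s(i, j)) (fun _ _ => Nat.zero_le _)
            (mem_univ j))
    _ = ∑ e, (if e.IsDiag then 1 else 2) • H.adj e := sum_sum_sym2 _
    _ ≤ 2 * ∑ e, H.adj e := by
        rw [Finset.mul_sum]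
        refine Finset.sum_le_sum fun e _ => ?_
        rw [smul_eq_mul]
        gcongr
        split_ifs <;> omega

theorem finite_edges_le (d : ℕ) : {H : GraphClass | H.edges ≤ d}.Finite := by
  refine ((Finset.finite_toSet ((Finset.range (d + 1)).biUnion fun i =>
    piAntidiag (univ : Finset (Sym2 (Fin (2 * d)))) i)).image graphClass).subset fun H hH => ?_
  obtain ⟨G, rfl⟩ := H.exists_mk
  have hH : (mk G).edges ≤ d := hH
  have hv : G.verts ≤ 2 * d := (verts_le_two_mul_edges (mk G)).trans (by omega)
  refine ⟨quot (Fin.castLE hv) G.adj, ?_, graphClass_quot G (Fin.castLE_injective hv)⟩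
  simp only [coe_biUnion, Set.mem_iUnion, mem_coe, mem_range, mem_piAntidiag, mem_univ,
    implies_true, and_true]
  refine ⟨_, Nat.lt_succ_of_le hH, ?_⟩
  rw [sum_quot]
  rfl

/-- The classes of graphs with at most `d` edges. -/
noncomputable def edgesLE (d : ℕ) : Finset GraphClass := (finite_edges_le d).toFinset

@[simp] theorem mem_edgesLE {d : ℕ} {H : GraphClass} : H ∈ edgesLE d ↔ H.edges ≤ d := by
  simp [edgesLE]

noncomputable instance (d : ℕ) : Fintype {H : GraphClass // H.edges ≤ d} :=
  Fintype.subtype (edgesLE d) fun _ => mem_edgesLE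

theorem sum_edgesLE (d : ℕ) (g : GraphClass → ℝ) :
    ∑ H ∈ edgesLE d, g H = ∑ H : {H : GraphClass // H.edges ≤ d}, g H.1 :=
  Finset.sum_subtype _ (fun _ => mem_edgesLE) _

/-- A sum over the refinements of `H` may be taken over any finite set containing them, if its
terms carry the refinement number as a factor. -/
theorem finsum_refines_eq {H : GraphClass} {T : Finset GraphClass}
    (hT : ∀ G, G.refCount H ≠ 0 → G ∈ T) {g : GraphClass → ℝ}
    (hg : ∀ G, G.refCount H = 0 → g G = 0) :
    ∑ᶠ (G : GraphClass) (_ : G.Refines H), g G = ∑ G ∈ T, g G := by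
  refine finsum_mem_eq_sum_of_inter_support_eq (s := {G | G.Refines H}) g ?_
  ext G
  simp only [Set.mem_inter_iff, Set.mem_ofPred_eq, Function.mem_support, mem_coe]
  refine and_congr_left fun h => ?_
  have h' : G.refCount H ≠ 0 := fun h0 => h (hg G h0)
  exact ⟨fun _ => hT G h', fun _ => refines_iff.2 h'⟩

end GraphClass

/-! ### Coefficients of freely-described polynomials -/

open MvPolynomial in
theorem coeff_killCompl {σ τ R : Type*} [CommSemiring R] {f : σ → τ} (hf : Function.Injective f)
    (p : MvPolynomial τ R) (m : σ →₀ ℕ) : (killCompl hf p).coeff m = p.coeff (m.mapDomain f) := by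
  classical
  induction p using MvPolynomial.induction_on' with
  | monomial s c =>
    by_cases hs : ↑s.support ⊆ Set.range f
    · obtain ⟨s, rfl⟩ : ∃ s' : σ →₀ ℕ, s'.mapDomain f = s :=
        ⟨s.comapDomain f hf.injOn, Finsupp.mapDomain_comapDomain f hf s hs⟩
      rw [killCompl_monomial_mapDomain, coeff_monomial, coeff_monomial]
      simp only [(Finsupp.mapDomain_injective hf).eq_iff]
    · rw [killCompl_monomial_eq_zero_of_not_subset hf c hs, coeff_zero, coeff_monomial, if_neg]
      rintro rfl
      refine hs fun x hx => ?_
      obtain ⟨y, -, rfl⟩ := Finset.mem_image.1 (Finsupp.mapDomain_support hx)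
      exact ⟨y, rfl⟩
  | add p q hp hq => rw [map_add, coeff_add, coeff_add, hp, hq]

open MvPolynomial in
/-- Evaluation at the relabelled and zero-padded matrix sets the entries outside the image to
zero. -/
theorem eval_killCompl_map {n N : ℕ} {f : Fin n → Fin N} (hf : Function.Injective f)
    (P : MvPolynomial (Sym2 (Fin N)) ℝ) (X : SymMat n ℝ) :
    eval X (killCompl (Sym2.map.injective hf) P) = eval (quot f X) P := by
  induction P using MvPolynomial.induction_on with
  | C a => rw [killCompl_C, eval_C, eval_C]
  | add p q hp hq => rw [map_add, map_add, map_add, hp, hq]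
  | mul_X p i hp =>
    rw [map_mul, map_mul, map_mul, hp, eval_X]
    congr 1
    by_cases hi : i ∈ Set.range (Sym2.map f)
    · obtain ⟨e, rfl⟩ := hi
      rw [quot_apply_map hf, ← rename_X, killCompl_rename_app, eval_X]
    · rw [quot_apply_eq_zero X fun e he => hi ⟨e, he⟩, killCompl, aeval_X, dif_neg hi, map_zero]

/-- The exponent vector of the monomial `X^K`. -/
noncomputable def exponent {n : ℕ} (K : SymMat n ℕ) : Sym2 (Fin n) →₀ ℕ :=
  Finsupp.equivFunOnFinite.symm K

@[simp] theorem exponent_apply {n : ℕ} (K : SymMat n ℕ) (e : Sym2 (Fin n)) :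
    exponent K e = K e := rfl

theorem exponent_quot {n N : ℕ} {f : Fin n → Fin N} (hf : Function.Injective f)
    (K : SymMat n ℕ) : exponent (quot f K) = (exponent K).mapDomain (Sym2.map f) := by
  ext e
  by_cases he : ∃ e', Sym2.map f e' = e
  · obtain ⟨e', rfl⟩ := he
    rw [Finsupp.mapDomain_apply (Sym2.map.injective hf), exponent_apply, quot_apply_map hf,
      exponent_apply]
  · rw [Finsupp.mapDomain_of_notMem_range _ _ he, exponent_apply]
    push Not at he
    exact quot_apply_eq_zero K he

theorem sum_degree_exponent {n : ℕ} (K : SymMat n ℕ) :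
    ((exponent K).sum fun _ a => a) = ∑ e, K e :=
  Finsupp.sum_fintype _ _ fun _ => rfl

theorem eval_monomial_exponent {n : ℕ} (K : SymMat n ℕ) (c : ℝ) (X : SymMat n ℝ) :
    MvPolynomial.eval X (MvPolynomial.monomial (exponent K) c) = c * monom K X := by
  rw [MvPolynomial.eval_monomial, Finsupp.prod_fintype _ _ fun _ => pow_zero _]
  rfl

/-- Distinct monomials are linearly independent as functions. -/
theorem coeff_eq_zero_of_sum_monom_eq_zero {n : ℕ} {S : Finset (SymMat n ℕ)}
    {c : SymMat n ℕ → ℝ} (h : ∀ X : SymMat n ℝ, ∑ K ∈ S, c K * monom K X = 0) {K : SymMat n ℕ}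
    (hK : K ∈ S) : c K = 0 := by
  have hP : ∑ K ∈ S, MvPolynomial.monomial (exponent K) (c K) = 0 := by
    refine MvPolynomial.funext fun X => ?_
    simpa [map_sum, eval_monomial_exponent] using h X
  have h2 := congrArg (MvPolynomial.coeff (exponent K)) hP
  rw [MvPolynomial.coeff_sum, MvPolynomial.coeff_zero,
    Finset.sum_eq_single_of_mem K hK fun L _ hL => ?_, MvPolynomial.coeff_monomial,
    if_pos rfl] at h2
  · exact h2
  · rw [MvPolynomial.coeff_monomial, if_neg fun h => hL ?_]
    exact Finsupp.equivFunOnFinite.symm.injective h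

/-- Permutation invariance and compatibility with zero-padding together say that the values are
unchanged under all injections of vertex sets. -/
theorem freelyDescribed_quot {d : ℕ} {p : (n : ℕ) → SymMat n ℝ → ℝ} (hp : p ∈ freelyDescribed d)
    {n N : ℕ} {f : Fin n → Fin N} (hf : Function.Injective f) (X : SymMat n ℝ) :
    p N (quot f X) = p n X := by
  have hn : n ≤ N := by simpa using Fintype.card_le_of_injective f hf
  obtain ⟨σ, hσ⟩ : ∃ σ : Equiv.Perm (Fin N), σ ∘ Fin.castLE hn = f := by
    let e : {x // x ∈ Set.range (Fin.castLE hn)} ≃ {x // x ∈ Set.range f} :=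
      (Equiv.ofInjective _ (Fin.castLE_injective hn)).symm.trans (Equiv.ofInjective f hf)
    refine ⟨e.extendSubtype, funext fun a => ?_⟩
    rw [Function.comp_apply, e.extendSubtype_apply_of_mem _ ⟨a, rfl⟩]
    exact congrArg (fun b => (Equiv.ofInjective f hf b : Fin N))
      (Equiv.ofInjective_symm_apply (Fin.castLE_injective hn) a)
  rw [← hσ, ← quot_quot, ← zeroPad_eq_quot hn, ← permute_eq_quot, hp.2.1, hp.2.2 n N hn]

namespace GraphClass

theorem monoSum_mem_freelyDescribed {d : ℕ} {H : GraphClass} (hH : H.edges ≤ d) :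
    H.monoSum ∈ freelyDescribed d := by
  refine ⟨fun n => ⟨∑ K ∈ H.labelings n, MvPolynomial.monomial (exponent K) 1, ?_, fun X => ?_⟩,
    fun n σ X => ?_, fun n N h X => ?_⟩
  · refine (MvPolynomial.totalDegree_finsetSum _ _).trans (Finset.sup_le fun K hK => ?_)
    refine (MvPolynomial.totalDegree_monomial_le _ _).trans ?_
    change ((exponent K).sum fun _ a => a) ≤ d
    rwa [sum_degree_exponent, ← edges_graphClass, mem_labelings.1 hK]
  · simp [monoSum_eq, map_sum, eval_monomial_exponent]
  · rw [permute_eq_quot, monoSum_quot_of_injective H σ.injective]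
  · rw [zeroPad_eq_quot h, monoSum_quot_of_injective H (Fin.castLE_injective h)]

/-- The coefficient of `X^K` in a freely-described polynomial depends only on the class of `K`,
so the polynomial is a combination of the `m_n^{[H]}`. -/
theorem exists_eq_sum_monoSum {d : ℕ} {p : (n : ℕ) → SymMat n ℝ → ℝ}
    (hp : p ∈ freelyDescribed d) :
    ∃ c : GraphClass → ℝ, ∀ n X, p n X = ∑ H ∈ edgesLE d, c H * H.monoSum n X := by
  choose P hdeg hP using hp.1
  have hquot : ∀ {n N : ℕ} {f : Fin n → Fin N}, Function.Injective f → ∀ K : SymMat n ℕ,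
      (P N).coeff (exponent (quot f K)) = (P n).coeff (exponent K) := by
    intro n N f hf K
    rw [exponent_quot hf, ← coeff_killCompl (Sym2.map.injective hf)]
    congr 1
    refine MvPolynomial.funext fun X => ?_
    rw [eval_killCompl_map hf, ← hP, ← hP, freelyDescribed_quot hp hf]
  -- Any representative of `H`, on exactly `|V(H)|` vertices, determines the coefficient of `m^{[H]}`.
  let c : GraphClass → ℝ := fun H => (P H.exists_mk.choose.verts).coeff
    (exponent H.exists_mk.choose.adj)
  have hc : ∀ {n : ℕ} (K : SymMat n ℕ), (P n).coeff (exponent K) = c (graphClass K) := by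
    intro n K
    obtain ⟨φ, hφ⟩ := graphClass_eq_iff.1 (graphClass K).exists_mk.choose_spec.symm
    conv_lhs => rw [← hφ]
    exact hquot φ.injective _
  refine ⟨c, fun n X => ?_⟩
  have hsum : P n = ∑ K ∈ labelingsOf (edgesLE d) n,
      MvPolynomial.monomial (exponent K) (c (graphClass K)) := by
    classical
    ext m
    obtain ⟨K, rfl⟩ : ∃ K : SymMat n ℕ, exponent K = m :=
      Finsupp.equivFunOnFinite.symm.surjective m
    have hinj : ∀ L : SymMat n ℕ, exponent L = exponent K ↔ L = K := fun L =>
      Finsupp.equivFunOnFinite.symm.injective.eq_iff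
    simp only [MvPolynomial.coeff_sum, MvPolynomial.coeff_monomial, hinj, Finset.sum_ite_eq',
      mem_labelingsOf, mem_edgesLE, edges_graphClass]
    split_ifs with h
    · exact hc K
    · refine MvPolynomial.coeff_eq_zero_of_totalDegree_lt ((hdeg n).trans_lt ?_)
      change d < (exponent K).sum fun _ a => a
      rw [sum_degree_exponent]
      omega
  rw [← sum_labelingsOf, hP, hsum, map_sum]
  exact Finset.sum_congr rfl fun K _ => eval_monomial_exponent K _ X

/-- The `m^{[H]}` are linearly independent: distinct classes have disjoint sets of labelings, and
`H` is itself one of its labelings on `|V(H)|` vertices. -/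
theorem coeff_eq_zero_of_sum_monoSum_eq_zero {T : Finset GraphClass} {a : GraphClass → ℝ}
    (h : ∀ n X, ∑ H ∈ T, a H * H.monoSum n X = 0) {H : GraphClass} (hH : H ∈ T) : a H = 0 := by
  obtain ⟨G, rfl⟩ := H.exists_mk
  have h' := fun X => (sum_labelingsOf T a G.verts X).trans (h G.verts X)
  have hG : G.adj ∈ labelingsOf T G.verts := by rwa [mem_labelingsOf, graphClass_adj]
  simpa [graphClass_adj] using coeff_eq_zero_of_sum_monom_eq_zero h' hG

end GraphClass

/-! ### The bases, by triangular change from the `m^{[H]}` -/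

/-- A family that is triangular with nonzero diagonal with respect to a rank function, in terms of
a finite basis, is linearly independent. -/
theorem linearIndependent_of_triangular {ι V : Type*} [Fintype ι] [AddCommGroup V] [Module ℝ V]
    {b φ : ι → V} (hb : LinearIndependent ℝ b) (A : ι → ι → ℝ) (r : ι → ℕ)
    (hφ : ∀ i, φ i = ∑ j, A i j • b j) (hA : ∀ i j, A i j ≠ 0 → i ≠ j → r i < r j)
    (hd : ∀ i, A i i ≠ 0) : LinearIndependent ℝ φ := by
  rw [Fintype.linearIndependent_iff] at hb ⊢
  intro g hg
  have h1 : ∀ j, ∑ i, g i * A i j = 0 := by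
    refine hb _ ?_
    rw [← hg]
    simp_rw [hφ, Finset.smul_sum, Finset.sum_smul, smul_smul]
    exact Finset.sum_comm
  intro j
  induction hr : r j using Nat.strong_induction_on generalizing j with | _ m ih =>
  subst hr
  have h2 := h1 j
  rw [Finset.sum_eq_single_of_mem j (mem_univ j) fun i _ hij => ?_] at h2
  · exact (mul_eq_zero.1 h2).resolve_right (hd j)
  · by_cases hz : A i j = 0
    · rw [hz, mul_zero]
    · rw [ih (r i) (hA i j hz hij) i rfl, zero_mul]

namespace GraphClass

theorem isFreeBasis_monoSum (d : ℕ) : IsFreeBasis d monoSum := by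
  classical
  let v : {H : GraphClass // H.edges ≤ d} → freelyDescribed d := fun H =>
    ⟨H.1.monoSum, monoSum_mem_freelyDescribed H.2⟩
  have hsum : ∀ c : GraphClass → ℝ,
      ((∑ H : {H : GraphClass // H.edges ≤ d}, c H.1 • v H : freelyDescribed d) :
        (n : ℕ) → SymMat n ℝ → ℝ) = fun n X => ∑ H ∈ edgesLE d, c H * H.monoSum n X := by
    intro c
    funext n X
    rw [sum_edgesLE]
    simp [v, Finset.sum_apply]
  have hli : LinearIndependent ℝ v := by
    rw [Fintype.linearIndependent_iff]
    intro g hg H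
    let a : GraphClass → ℝ := fun H => if h : H.edges ≤ d then g ⟨H, h⟩ else 0
    have ha : ∀ H : {H : GraphClass // H.edges ≤ d}, a H.1 = g H := fun H => dif_pos H.2
    rw [← ha]
    refine coeff_eq_zero_of_sum_monoSum_eq_zero (T := edgesLE d) (fun n X => ?_) (mem_edgesLE.2 H.2)
    have := hsum a
    simp_rw [ha] at this
    rw [hg] at this
    exact (congrFun (congrFun this n) X).symm
  refine ⟨Module.Basis.mk hli fun p _ => ?_, fun H => by simp [v]⟩
  obtain ⟨c, hc⟩ := exists_eq_sum_monoSum p.2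
  have : p = ∑ H, c H.1 • v H := Subtype.ext (by rw [hsum]; funext n X; exact hc n X)
  rw [this]
  exact Submodule.sum_mem _ fun H _ => Submodule.smul_mem _ _ (Submodule.subset_span ⟨H, rfl⟩)

/-- A family with triangular coefficients in the basis `m^{[H]}` is again a basis. -/
theorem isFreeBasis_of_triangular {d : ℕ} {φ : GraphClass → (n : ℕ) → SymMat n ℝ → ℝ}
    (A : GraphClass → GraphClass → ℝ) (r : GraphClass → ℕ)
    (hφ : ∀ H : GraphClass, H.edges ≤ d →
      ∀ n X, φ H n X = ∑ G ∈ edgesLE d, A H G * G.monoSum n X)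
    (hA : ∀ H G : GraphClass, H.edges ≤ d → G.edges ≤ d → A H G ≠ 0 → H ≠ G → r H < r G)
    (hd : ∀ H : GraphClass, H.edges ≤ d → A H H ≠ 0) : IsFreeBasis d φ := by
  classical
  obtain ⟨b, hb⟩ := isFreeBasis_monoSum d
  let v : {H : GraphClass // H.edges ≤ d} → freelyDescribed d := fun H => ∑ G, A H.1 G.1 • b G
  have hv : ∀ H, (v H : (n : ℕ) → SymMat n ℝ → ℝ) = φ H := by
    intro H
    funext n X
    rw [hφ H.1 H.2, sum_edgesLE]
    simp [v, hb, Finset.sum_apply]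
  have hli : LinearIndependent ℝ v := linearIndependent_of_triangular b.linearIndependent
    (fun H G => A H.1 G.1) (fun H => r H.1) (fun _ => rfl)
    (fun H G h hne => hA H.1 G.1 H.2 G.2 h fun h' => hne (Subtype.ext h')) fun H => hd H.1 H.2
  have : Module.Finite ℝ (freelyDescribed d) := Module.Finite.of_basis b
  exact ⟨basisOfLinearIndependentOfCardEqFinrank' v hli (Module.finrank_eq_card_basis b).symm,
    fun H => by rw [coe_basisOfLinearIndependentOfCardEqFinrank', hv]⟩

theorem isFreeBasis_inj (d : ℕ) : IsFreeBasis d inj := by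
  classical
  refine isFreeBasis_of_triangular (fun H G => if H = G then (H.refCount H : ℝ) else 0) verts
    (fun H hH n X => ?_) (fun H G _ _ h hne => absurd (if_neg hne) h) fun H _ => ?_
  · simp [inj_eq, hH]
  · simpa using refCount_self_ne_zero H

theorem isFreeBasis_hom (d : ℕ) : IsFreeBasis d hom := by
  -- The graphs occurring in `hom H` have fewer vertices than `H`, so the rank is reversed.
  refine isFreeBasis_of_triangular (fun H G => (H.refCount G : ℝ)) (fun H => 2 * d - H.verts)
    (fun H hH n X => hom_eq (fun G h => ?_) n X) (fun H G hH _ h hne => ?_)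
    fun H _ => by exact_mod_cast refCount_self_ne_zero H
  · rw [mem_edgesLE, ← edges_eq_of_refCount_ne_zero h]
    exact hH
  · have h1 := verts_lt_of_refCount_ne_zero (by exact_mod_cast h) hne
    have h2 := verts_le_two_mul_edges H
    omega

theorem mem_edgesLE_of_refCount {d : ℕ} {H : GraphClass} (hH : H.edges ≤ d) (G : GraphClass)
    (h : G.refCount H ≠ 0) : G ∈ edgesLE d := by
  rwa [mem_edgesLE, edges_eq_of_refCount_ne_zero h]

theorem verts_lt_of_quotCoeff_ne_zero {k : ℕ} {H G : GraphClass} (h : quotCoeff k H G ≠ 0)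
    (hne : H ≠ G) : H.verts < G.verts :=
  verts_lt_of_refCount_ne_zero (refCount_ne_zero_of_quotCoeff h) hne.symm

theorem quotCoeff_self_ne_zero {k : ℕ} (hk : 0 < k) {H : GraphClass} (hH : H.verts ≤ k) :
    quotCoeff k H H ≠ 0 := by
  have hR : (H.refCount H : ℝ) ≠ 0 := by exact_mod_cast refCount_self_ne_zero H
  have hD : (k.descFactorial H.verts : ℝ) ≠ 0 := by
    exact_mod_cast fun h => hH.not_gt (Nat.descFactorial_eq_zero_iff_lt.1 h)
  have hF : (H.fact : ℝ) ≠ 0 := Nat.cast_ne_zero.2 H.fact_ne_zero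
  have hK : (k : ℝ) ^ H.verts ≠ 0 := by positivity
  exact mul_ne_zero (mul_ne_zero (div_ne_zero hF hF) (div_ne_zero hD hK)) (div_ne_zero hR hR)

theorem isFreeBasis_quotExp {d k : ℕ} (hk : 0 < k) (hdk : 2 * d ≤ k) :
    IsFreeBasis d (quotExp k) :=
  isFreeBasis_of_triangular (quotCoeff k) verts
    (fun _ hH n X => quotExp_eq hk (mem_edgesLE_of_refCount hH) n X)
    (fun _ _ _ _ h hne => verts_lt_of_quotCoeff_ne_zero h hne)
    fun H hH => quotCoeff_self_ne_zero hk (by have := verts_le_two_mul_edges H; omega)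

theorem isFreeBasis_pushExp {d k : ℕ} (hk : 0 < k) (hdk : 2 * d ≤ k) :
    IsFreeBasis d (pushExp k) :=
  isFreeBasis_of_triangular (fun H G => (2 : ℝ) ^ (H.loops - G.loops : ℤ) * quotCoeff k H G) verts
    (fun _ hH n X => pushExp_eq hk (mem_edgesLE_of_refCount hH) n X)
    (fun _ _ _ _ h hne => verts_lt_of_quotCoeff_ne_zero (right_ne_zero_of_mul h) hne)
    fun H hH => mul_ne_zero (by positivity)
      (quotCoeff_self_ne_zero hk (by have := verts_le_two_mul_edges H; omega))

end GraphClass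

theorem mainTheorem10 :
    (∀ (k : ℕ) (H : GraphClass), 0 < k → H.verts ≤ k →
      {G : GraphClass | G.Refines H}.Finite ∧
      (∀ (n : ℕ) (X : SymMat n ℝ),
        H.quotExp k n X =
          ∑ᶠ (G : GraphClass) (_ : G.Refines H),
            ((H.fact : ℝ) / G.fact) * ((k.descFactorial H.verts : ℝ) / (k : ℝ) ^ G.verts) *
              ((G.refCount H : ℝ) / H.refCount H) * G.monoSum n X) ∧
      (∀ (n : ℕ) (X : SymMat n ℝ),
        H.pushExp k n X =
          ∑ᶠ (G : GraphClass) (_ : G.Refines H),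
            (2 : ℝ) ^ (H.loops - G.loops : ℤ) *
              (((H.fact : ℝ) / G.fact) * ((k.descFactorial H.verts : ℝ) / (k : ℝ) ^ G.verts) *
                ((G.refCount H : ℝ) / H.refCount H)) * G.monoSum n X)) ∧
    (∀ d : ℕ,
      (∀ k : ℕ, 0 < k → 2 * d ≤ k →
        IsFreeBasis d (GraphClass.quotExp k) ∧ IsFreeBasis d (GraphClass.pushExp k)) ∧
      IsFreeBasis d GraphClass.monoSum ∧
      IsFreeBasis d GraphClass.inj ∧
      IsFreeBasis d GraphClass.hom) := by
  refine ⟨fun k H hk _ => ?_, fun d => ⟨fun k hk hdk => ⟨GraphClass.isFreeBasis_quotExp hk hdk,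
    GraphClass.isFreeBasis_pushExp hk hdk⟩, GraphClass.isFreeBasis_monoSum d,
    GraphClass.isFreeBasis_inj d, GraphClass.isFreeBasis_hom d⟩⟩
  have hT := GraphClass.mem_edgesLE_of_refCount (le_refl H.edges)
  refine ⟨?_, fun n X => ?_, fun n X => ?_⟩
  · refine (GraphClass.edgesLE H.edges).finite_toSet.subset fun G hG => ?_
    exact hT G (GraphClass.refines_iff.1 hG)
  · rw [GraphClass.finsum_refines_eq hT fun G h => by simp [h]]
    exact GraphClass.quotExp_eq hk hT n X
  · rw [GraphClass.finsum_refines_eq hT fun G h => by simp [h]]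
    exact GraphClass.pushExp_eq hk hT n X
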